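/- **Corollary 1.3.** Let $\mathcal H$ be a complex Hilbert space of functions on a set $X$ in which all point evaluations are bounded, with reproducing kernel $k$ (so $k(\cdot,w)\in\mathcal H$ and $f(w)=\langle f,k(\cdot,w)\rangle$ for all $f\in\mathcal H$, $w\in X$). Let $$\operatorname{Mult}(\mathcal H)=\{\varphi:X\to\mathbb C : \varphi f\in\mathcal H\text{ for all }f\in\mathcal H\},$$ and equip $M_r(\operatorname{Mult}(\mathcal H))$ with the norm of the multiplication operators on $\mathcal H^r$, the Hilbert space direct sum of $r$ copies of $\mathcal H$. Suppose that * $\mathcal H$ is *normalized*: there is $x_0\in X$ with $k(x,x_0)=1$ for all $x\in X$ (so that $1\in\mathcal H$ and $\operatorname{Mult}(\mathcal H)\subset\mathcal H$); * $\mathcal H$ is a *complete Pick space*: for every $r\in\mathbb N$, all finitely many points $z_1,\dots,z_n\in X$ and all $W_1,\dots,W_n\in M_r(\mathbb C)$, if the $nr\times nr$ block matrix $[k(z_i,z_j)(I_{\mathbb C^r}-W_iW_j^*)]_{i,j=1}^n$ is positive semidefinite, then there is $\Phi\in M_r(\operatorname{Mult}(\mathcal H))$ of norm at most $1$ with $\Phi(z_i)=W_i$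 for $i=1,\dots,n$. Let $\rho:\mathcal H\to\mathbb C$ be a non-zero bounded linear functional. Then the following are equivalent: 1. $\rho(\varphi g)=\rho(\varphi)\rho(g)$ for all $\varphi\in\operatorname{Mult}(\mathcal H)$ and all $g\in\mathcal H$; 2. $\rho(fg)=\rho(f)\rho(g)$ for all $f,g\in\mathcal H$ such that $fg\in\mathcal H$. -/

import Mathlib

open scoped ComplexOrder Matrix

namespace PickSpace

section

variable {X : Type*} (H : Type*) [NormedAddCommGroup H] [InnerProductSpace ℂ H] [RKHS ℂ H X ℂ]

/-- The multiplier algebra `Mult(H)`: all functions `φ : X → ℂ` such that `φ f ∈ H` for every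
`f ∈ H`. -/
def Mult : Subalgebra ℂ (X → ℂ) where
  carrier := {φ | ∀ f : H, ∃ g : H, (g : X → ℂ) = φ * f}
  mul_mem' := by
    intro φ ψ hφ hψ f
    obtain ⟨g, hg⟩ := hψ f
    obtain ⟨h, hh⟩ := hφ g
    exact ⟨h, by rw [hh, hg, mul_assoc]⟩
  add_mem' := by
    intro φ ψ hφ hψ f
    obtain ⟨g, hg⟩ := hφ f
    obtain ⟨h, hh⟩ := hψ f
    exact ⟨g + h, by rw [RKHS.coe_add, hg, hh, add_mul]⟩
  algebraMap_mem' := by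
    intro c f
    exact ⟨c • f, by rw [RKHS.coe_smul, Algebra.algebraMap_eq_smul_one, smul_mul_assoc, one_mul]⟩

variable {H}

theorem exists_coe_eq_mul (φ : Mult H) (f : H) : ∃ g : H, (g : X → ℂ) = (φ : X → ℂ) * f := φ.2 f

/-- The product `φ f ∈ H` of a multiplier `φ` and a function `f ∈ H`. -/
noncomputable def mulFun (φ : Mult H) (f : H) : H := (exists_coe_eq_mul φ f).choose

theorem coe_mulFun (φ : Mult H) (f : H) : ⇑(mulFun φ f) = (φ : X → ℂ) * f :=
  (exists_coe_eq_mul φ f).choose_spec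

/-- The multiplication operator `M_φ : H → H`, `f ↦ φ f`, of a multiplier `φ`. -/
noncomputable def mulOp (φ : Mult H) : H →ₗ[ℂ] H where
  toFun := mulFun φ
  map_add' f g := DFunLike.coe_injective <| by
    simp only [RKHS.coe_add, coe_mulFun, mul_add]
  map_smul' c f := DFunLike.coe_injective <| by
    simp only [RingHom.id_apply, RKHS.coe_smul, coe_mulFun, mul_smul_comm]

theorem coe_mulOp (φ : Mult H) (f : H) : ⇑(mulOp φ f) = (φ : X → ℂ) * f :=
  coe_mulFun φ f

/-- A matrix of multipliers `Φ ∈ M_r(Mult(H))` has norm at most `1`: the operator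
`(f_j)_j ↦ (∑ j, Φ_{ij} f_j)_i` is a contraction on the Hilbert space direct sum
of `r` copies of `H`. -/
def IsContractiveMultiplier {r : ℕ} (Φ : Matrix (Fin r) (Fin r) (Mult H)) : Prop :=
  ∀ F : Fin r → H, ∑ i, ‖∑ j, mulOp (Φ i j) (F j)‖ ^ 2 ≤ ∑ j, ‖F j‖ ^ 2

variable (H) [CompleteSpace H]

/-- The scalar reproducing kernel `k(z,w)`, so that `f(w) = ⟨f, k(·,w)⟩` for `f ∈ H`. -/
noncomputable def ker (z w : X) : ℂ := RKHS.kernel H z w 1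

/-- `H` is normalized: there is `x₀` with `k(x,x₀) = 1` for all `x`. -/
def IsNormalized : Prop := ∃ x₀ : X, ∀ x : X, ker H x x₀ = 1

/-- `H` is a complete Pick space: for all `r`, all points `z_1, …, z_n` and all `r × r` matrices
`W_1, …, W_n`, if the block matrix `[k(z_i,z_j) (I - W_i W_j^*)]` is positive (semidefinite), then
some `Φ ∈ M_r(Mult(H))` of norm at most `1` satisfies `Φ(z_i) = W_i` for all `i`. -/
def IsCompletePick : Prop :=
  ∀ (r n : ℕ) (z : Fin n → X) (W : Fin n → Matrix (Fin r) (Fin r) ℂ),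
    (Matrix.of fun p q : Fin n × Fin r =>
      ker H (z p.1) (z q.1) * (1 - W p.1 * (W q.1)ᴴ) p.2 q.2).PosSemidef →
    ∃ Φ : Matrix (Fin r) (Fin r) (Mult H), IsContractiveMultiplier Φ ∧
      ∀ i a b, (Φ a b : X → ℂ) (z i) = W i a b

variable {H}

/-- If `H` is normalized, then `Mult(H) ⊆ H`. -/
theorem exists_coe_eq_mult (hN : IsNormalized H) (φ : Mult H) : ∃ f : H, (f : X → ℂ) = φ := by
  obtain ⟨x₀, hx₀⟩ := hN
  refine ⟨mulOp φ (RKHS.kerFun H x₀ (1 : ℂ)), (coe_mulOp φ _).trans ?_⟩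
  funext x
  have h : (RKHS.kerFun H x₀ (1 : ℂ) : H) x = 1 :=
    (RKHS.kerFun_apply H x₀ (1 : ℂ) x).trans (hx₀ x)
  rw [Pi.mul_apply, h, mul_one]

/-- A multiplier of a normalized space, regarded as an element of the space. -/
noncomputable def multToSpace (hN : IsNormalized H) (φ : Mult H) : H :=
  (exists_coe_eq_mult hN φ).choose

theorem coe_multToSpace (hN : IsNormalized H) (φ : Mult H) :
    ⇑(multToSpace hN φ) = φ :=
  (exists_coe_eq_mult hN φ).choose_spec

end

end PickSpace

/-!
Write `K` for the kernel. By Agler and McCarthy, a normalized complete Pick kernel has the form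
`K(z,w) = 1 / (1 - ⟪b z, b w⟫)` with `b` mapping `X` into the unit ball of an inner product space;
the Pick property lets one construct `b` one point at a time. The row of coordinates of `b` is then
a contractive multiplier, so the kernel functions `k_z = K(·,z)` are multipliers, and the Schur
product theorem gives
`K(z,w) (⟪p z, k_w p w⟫ + ⟪k_z p z, p w⟫ - ⟪p z, p w⟫) ≥ 0` for every `p : X → H`.

For a unit vector `f` let `s z = ⟪k_z f, f⟫`. Two choices of `p` in the inequality show that
`φ = f / s` and `ψ = 1 - 1 / s` are contractive multipliers, so `φ = (1 - ψ) f`. A functional that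
is multiplicative in the sense of (1) is then multiplicative on all products `f g`, provided that it
does not vanish at `1 - ψ`. If it did, its Riesz vector would be fixed by the adjoint of the
contraction `M_ψ`, hence by `M_ψ`, and would be zero because `ψ` omits the value `1`.
-/

open Matrix
open scoped InnerProductSpace ComplexConjugate

namespace PickSpace

universe u

section Gram

variable {ι 𝕜 E F : Type*} [RCLike 𝕜] [NormedAddCommGroup E] [InnerProductSpace 𝕜 E]
  [NormedAddCommGroup F] [InnerProductSpace 𝕜 F]

theorem finsuppSum_gram (v : ι → E) (c : ι →₀ 𝕜) :
    (c.sum fun i a ↦ c.sum fun j b ↦ star a * gram 𝕜 v i j * b) =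
      ((‖c.linearCombination 𝕜 v‖ ^ 2 : ℝ) : 𝕜) := by
  rw [RCLike.ofReal_pow, ← inner_self_eq_norm_sq_to_K]
  simp only [Finsupp.linearCombination_apply, Finsupp.sum, sum_inner, inner_sum, gram_apply,
    inner_smul_left, inner_smul_right, RCLike.star_def]
  rw [Finset.sum_comm]
  simp only [Finset.mul_sum, mul_left_comm, mul_comm]

theorem posSemidef_gram_sub_gram_iff (u : ι → E) (v : ι → F) :
    (gram 𝕜 u - gram 𝕜 v).PosSemidef ↔
      ∀ c : ι →₀ 𝕜, ‖c.linearCombination 𝕜 v‖ ≤ ‖c.linearCombination 𝕜 u‖ := by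
  have quad (c : ι →₀ 𝕜) :
      (c.sum fun i a ↦ c.sum fun j b ↦ star a * (gram 𝕜 u - gram 𝕜 v) i j * b) =
        ((‖c.linearCombination 𝕜 u‖ ^ 2 - ‖c.linearCombination 𝕜 v‖ ^ 2 : ℝ) : 𝕜) := by
    simp only [Matrix.sub_apply, mul_sub, sub_mul, Finsupp.sum_sub, RCLike.ofReal_sub,
      finsuppSum_gram]
  simp only [PosSemidef, quad, RCLike.ofReal_nonneg, sub_nonneg,
    sq_le_sq₀ (norm_nonneg _) (norm_nonneg _)]
  exact and_iff_right ((isHermitian_gram ..).sub (isHermitian_gram ..))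

theorem posSemidef_gram (v : ι → E) : (gram 𝕜 v).PosSemidef := by
  simpa using (posSemidef_gram_sub_gram_iff (𝕜 := 𝕜) v (0 : ι → E)).2 fun c ↦ by
    simp [Finsupp.linearCombination_zero]

theorem exists_gram_eq_of_posSemidef {X : Type u} {M : Matrix X X ℂ} (hM : M.PosSemidef) :
    ∃ (G : Type u) (_ : NormedAddCommGroup G) (_ : InnerProductSpace ℂ G) (v : X → G),
      gram ℂ v = M := by
  let K : Matrix X X (ℂ →L[ℂ] ℂ) := .of fun x y ↦ M x y • 1
  have hK : K.PosSemidef := by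
    refine ((RKHS.posSemidef_tfae (K := K)).out 0 2 :).2 ⟨?_, fun c ↦ ?_⟩
    · ext x y
      simp [K, Matrix.conjTranspose_apply, ← hM.1.apply x y]
    · convert! (Complex.nonneg_iff.1 (hM.2 c)).1 using 8 with _ x a _ y
      simp [K, ← hM.1.apply x y, mul_comm]
  have : Fact K.PosSemidef := ⟨hK⟩
  refine ⟨RKHS.OfKernel K, inferInstance, inferInstance,
    fun x ↦ RKHS.kerFun (RKHS.OfKernel K) x (1 : ℂ), ?_⟩
  ext x y
  rw [gram_apply, RKHS.kerFun_inner]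
  simp [RKHS.kerFun_apply, RKHS.OfKernel.kernel_ofKernel, K]

theorem apply_eq_apply_of_posSemidef {M : Matrix ι ι ℂ} (hM : M.PosSemidef) {x y : ι}
    (hx : M x x = M x y) (hy : M y y = M x y) (z : ι) : M z x = M z y := by
  obtain ⟨G, _, _, v, rfl⟩ := exists_gram_eq_of_posSemidef hM
  simp only [gram_apply] at hx hy ⊢
  have hyx : ⟪v y, v x⟫_ℂ = ⟪v x, v y⟫_ℂ := by
    rw [← inner_conj_symm, ← hx, inner_conj_symm]
  have hv : v x - v y = 0 := by
    rw [← inner_self_eq_zero (𝕜 := ℂ)]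
    simp only [inner_sub_left, inner_sub_right, hx, hy, hyx, sub_self]
  rw [sub_eq_zero.1 hv]

theorem one_le_apply_self_of_posSemidef {M : Matrix ι ι ℂ} (hM : M.PosSemidef)
    {x y : ι} (hx : M x x = 1) (hxy : M x y = 1) : 1 ≤ M y y := by
  obtain ⟨G, _, _, v, rfl⟩ := exists_gram_eq_of_posSemidef hM
  simp only [gram_apply] at hx hxy ⊢
  have hyx : ⟪v y, v x⟫_ℂ = 1 := by rw [← inner_conj_symm, hxy, map_one]
  have hnonneg : 0 ≤ ⟪v y - v x, v y - v x⟫_ℂ := by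
    rw [inner_self_eq_norm_sq_to_K]
    positivity
  simp only [inner_sub_left, inner_sub_right, hx, hxy, hyx, sub_self, sub_zero] at hnonneg
  exact sub_nonneg.1 hnonneg

end Gram

section ReproducingKernel

variable {X H : Type*} [NormedAddCommGroup H] [InnerProductSpace ℂ H] [RKHS ℂ H X ℂ]

theorem mulOp_apply_apply (φ : Mult H) (f : H) (x : X) :
    mulOp φ f x = (φ : X → ℂ) x * f x := by
  rw [coe_mulOp, Pi.mul_apply]

theorem mulOp_one_sub_apply (ψ : Mult H) (g : H) : mulOp (1 - ψ) g = g - mulOp ψ g :=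
  RKHS.ext fun x ↦ by simp [mulOp_apply_apply, sub_mul]

theorem coe_finsetSum_apply {ι : Type*} (s : Finset ι) (F : ι → H) (x : X) :
    (∑ i ∈ s, F i) x = ∑ i ∈ s, F i x := by
  rw [← RKHS.coeCLM_apply, map_sum, Finset.sum_apply]
  rfl

variable [CompleteSpace H]

variable (H) in
/-- The kernel function `k(·, w)`, as an element of the space. -/
noncomputable def kerVec (w : X) : H := RKHS.kerFun H w (1 : ℂ)

theorem inner_kerVec_left (x : X) (f : H) : ⟪kerVec H x, f⟫_ℂ = f x := by
  simp [kerVec]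

theorem inner_kerVec_right (x : X) (f : H) : ⟪f, kerVec H x⟫_ℂ = conj (f x) := by
  simp [kerVec]

theorem kerVec_apply (z w : X) : kerVec H w z = ker H z w :=
  RKHS.kerFun_apply H w (1 : ℂ) z

theorem ker_eq_inner (z w : X) : ker H z w = ⟪kerVec H z, kerVec H w⟫_ℂ := by
  rw [inner_kerVec_left, kerVec_apply]

theorem conj_ker (z w : X) : conj (ker H z w) = ker H w z := by
  rw [ker_eq_inner, ker_eq_inner, inner_conj_symm]

theorem ker_self (z : X) : ker H z z = ((‖kerVec H z‖ ^ 2 : ℝ) : ℂ) := by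
  rw [ker_eq_inner, inner_self_eq_norm_sq_to_K, Complex.ofReal_pow]
  rfl

theorem kerVec_ne_zero {x₀ : X} (hx₀ : ∀ x, ker H x x₀ = 1) (x : X) : kerVec H x ≠ 0 := by
  intro h
  simpa [ker_eq_inner, h] using hx₀ x

variable (H) in
theorem denseRange_linearCombination_kerVec :
    DenseRange (Finsupp.linearCombination ℂ (kerVec H) : (X →₀ ℂ) → H) := by
  have hspan : Submodule.span ℂ {RKHS.kerFun H x v | (x : X) (v : ℂ)} ≤
      LinearMap.range (Finsupp.linearCombination ℂ (kerVec H)) := by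
    rw [Submodule.span_le]
    rintro _ ⟨x, v, rfl⟩
    exact ⟨Finsupp.single x v, by simp [kerVec, ← map_smul]⟩
  rw [DenseRange, ← LinearMap.coe_range, Submodule.dense_iff_topologicalClosure_eq_top,
    ← top_le_iff, ← RKHS.kerFun_dense (𝕜 := ℂ) H]
  exact Submodule.topologicalClosure_mono hspan

/-- A version of Douglas' lemma: both sides say that `τ ↦ ⟪v ·, τ⟫` is a contraction into `H`. -/
theorem posSemidef_gram_kerVec_sub_gram_iff {E : Type*} [NormedAddCommGroup E]
    [InnerProductSpace ℂ E] (v : X → E) :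
    (gram ℂ (kerVec H) - gram ℂ v).PosSemidef ↔
      ∀ τ : E, ∃ h : H, ‖h‖ ≤ ‖τ‖ ∧ ∀ x, h x = ⟪v x, τ⟫_ℂ := by
  rw [posSemidef_gram_sub_gram_iff]
  refine ⟨fun hle τ ↦ ?_, fun hex c ↦ ?_⟩
  · let ℓ : (X →₀ ℂ) →ₗ[ℂ] ℂ := (innerSL ℂ τ).toLinearMap ∘ₗ Finsupp.linearCombination ℂ v
    have hℓ (c : X →₀ ℂ) : ‖ℓ c‖ ≤ ‖τ‖ * ‖c.linearCombination ℂ (kerVec H)‖ :=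
      (norm_inner_le_norm _ _).trans (by gcongr; exact hle c)
    have hdense := denseRange_linearCombination_kerVec H
    refine ⟨(InnerProductSpace.toDual ℂ H).symm
      (ℓ.extendOfNorm (Finsupp.linearCombination ℂ (kerVec H))), ?_, fun x ↦ ?_⟩
    · rw [LinearIsometryEquiv.norm_map]
      exact LinearMap.opNorm_extendOfNorm_le hdense (norm_nonneg _) hℓ
    · have := LinearMap.extendOfNorm_eq hdense ⟨_, hℓ⟩ (Finsupp.single x 1)
      rw [Finsupp.linearCombination_single, one_smul] at this
      rw [← inner_kerVec_left, ← inner_conj_symm, InnerProductSpace.toDual_symm_apply, this]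
      simp [ℓ]
  · set V := c.linearCombination ℂ v with hV
    set K := c.linearCombination ℂ (kerVec H) with hK
    obtain ⟨h, hh, hv⟩ := hex V
    have hinner : ⟪K, h⟫_ℂ = ⟪V, V⟫_ℂ := by
      nth_rw 1 [hV]
      simp only [hK, Finsupp.linearCombination_apply, Finsupp.sum_inner, inner_smul_left,
        inner_kerVec_left, hv]
    have hsq : ‖V‖ * ‖V‖ ≤ ‖K‖ * ‖V‖ := by
      calc
        ‖V‖ * ‖V‖ = ‖⟪K, h⟫_ℂ‖ := by
          rw [hinner, ← inner_self_eq_norm_mul_norm (𝕜 := ℂ), inner_self_re_eq_norm]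
        _ ≤ ‖K‖ * ‖V‖ := (norm_inner_le_norm _ _).trans (by gcongr)
    rcases (norm_nonneg V).eq_or_lt' with h0 | hpos
    · exact h0.trans_le (norm_nonneg K)
    · exact le_of_mul_le_mul_right hsq hpos

theorem exists_mult_of_posSemidef {φ : X → ℂ}
    (hφ : (of fun z w ↦ ker H z w * (1 - φ z * conj (φ w))).PosSemidef) :
    ∃ Φ : Mult H, (Φ : X → ℂ) = φ ∧ ∀ f, ‖mulOp Φ f‖ ≤ ‖f‖ := by
  have hgram : gram ℂ (kerVec H) - gram ℂ (fun x ↦ conj (φ x) • kerVec H x) =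
      of fun z w ↦ ker H z w * (1 - φ z * conj (φ w)) := by
    ext z w
    simp only [Matrix.sub_apply, gram_apply, of_apply, inner_smul_left, inner_smul_right,
      ← ker_eq_inner, Complex.conj_conj]
    ring
  rw [← hgram, posSemidef_gram_kerVec_sub_gram_iff] at hφ
  choose M hM hMφ using hφ
  simp only [inner_smul_left, Complex.conj_conj, inner_kerVec_left] at hMφ
  let Φ : Mult H := ⟨φ, fun f ↦ ⟨M f, funext (hMφ f)⟩⟩
  have hΦ (f : H) : mulOp Φ f = M f := RKHS.ext fun x ↦ by rw [mulOp_apply_apply, hMφ]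
  exact ⟨Φ, rfl, fun f ↦ (hΦ f).symm ▸ hM f⟩

theorem IsContractiveMultiplier.posSemidef_row {r : ℕ} {Φ : Matrix (Fin r) (Fin r) (Mult H)}
    (hΦ : IsContractiveMultiplier Φ) (i : Fin r) :
    (of fun z w ↦
      ker H z w * (1 - ∑ a, (Φ i a : X → ℂ) z * conj ((Φ i a : X → ℂ) w))).PosSemidef := by
  let v (z : X) : PiLp 2 fun _ : Fin r ↦ H :=
    WithLp.toLp 2 fun a ↦ conj ((Φ i a : X → ℂ) z) • kerVec H z
  have hgram : gram ℂ (kerVec H) - gram ℂ v =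
      of fun z w ↦ ker H z w * (1 - ∑ a, (Φ i a : X → ℂ) z * conj ((Φ i a : X → ℂ) w)) := by
    ext z w
    simp only [v, Matrix.sub_apply, gram_apply, of_apply, PiLp.inner_apply, inner_smul_left,
      inner_smul_right, ← ker_eq_inner, Complex.conj_conj, mul_sub, mul_one, Finset.mul_sum]
    congr! 2
    ring
  rw [← hgram, posSemidef_gram_kerVec_sub_gram_iff]
  refine fun F ↦ ⟨∑ a, mulOp (Φ i a) (F a), ?_, fun x ↦ ?_⟩
  · rw [← sq_le_sq₀ (norm_nonneg _) (norm_nonneg _), PiLp.norm_sq_eq_of_L2]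
    exact (Finset.single_le_sum (f := fun i ↦ ‖∑ a, mulOp (Φ i a) (F a)‖ ^ 2)
      (fun _ _ ↦ by positivity) (Finset.mem_univ i)).trans (hΦ F)
  · simp only [v, coe_finsetSum_apply, mulOp_apply_apply, PiLp.inner_apply, inner_smul_left,
      inner_kerVec_left, Complex.conj_conj]

end ReproducingKernel

section CompletePick

variable {X : Type u} {H : Type*} [NormedAddCommGroup H] [InnerProductSpace ℂ H] [CompleteSpace H]
  [RKHS ℂ H X ℂ]

theorem IsCompletePick.exists_extension (hP : IsCompletePick H) {r : ℕ} (S : Finset X)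
    (b : X → EuclideanSpace ℂ (Fin (r + 1)))
    (hb : (of fun z w : S ↦ ker H (z : X) w * (1 - ⟪b z, b w⟫_ℂ)).PosSemidef) :
    ∃ β : X → EuclideanSpace ℂ (Fin (r + 1)), (∀ z ∈ S, β z = b z) ∧
      (of fun z w ↦ ker H z w * (1 - ⟪β z, β w⟫_ℂ)).PosSemidef := by
  let z (i : Fin S.card) : S := S.equivFin.symm i
  -- The first row of `W i` is the adjoint of `b (z i)`, so `W i * (W j)ᴴ` lives in the corner.
  let W (i : Fin S.card) : Matrix (Fin (r + 1)) (Fin (r + 1)) ℂ :=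
    of fun a c ↦ if a = 0 then conj (b (z i) c) else 0
  have hW (i j : Fin S.card) (a c : Fin (r + 1)) :
      (W i * (W j)ᴴ) a c = if a = 0 ∧ c = 0 then ⟪b (z i), b (z j)⟫_ℂ else 0 := by
    by_cases ha : a = 0 <;> by_cases hc : c = 0 <;>
      simp [W, Matrix.mul_apply, ha, hc, PiLp.inner_apply, mul_comm]
  have hblock : (of fun p q : Fin S.card × Fin (r + 1) ↦
      ker H (z p.1 : X) (z q.1) * (1 - W p.1 * (W q.1)ᴴ) p.2 q.2).PosSemidef := by
    have hfirst := (hb.submatrix z).kronecker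
      (PosSemidef.diagonal (n := Fin (r + 1)) (R := ℂ) (d := fun a ↦ if a = 0 then 1 else 0)
        (fun a ↦ by dsimp only; split_ifs <;> simp))
    have hrest := ((posSemidef_gram (kerVec H)).submatrix fun i ↦ (z i : X)).kronecker
      (PosSemidef.diagonal (n := Fin (r + 1)) (R := ℂ) (d := fun a ↦ if a = 0 then 0 else 1)
        (fun a ↦ by dsimp only; split_ifs <;> simp))
    convert! hfirst.add hrest using 1
    ext ⟨i, a⟩ ⟨j, c⟩
    simp only [Matrix.add_apply, kroneckerMap_apply, submatrix_apply, of_apply, gram_apply,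
      Matrix.sub_apply, hW, Matrix.one_apply, diagonal_apply, ← ker_eq_inner]
    by_cases hac : a = c <;> by_cases ha : a = 0 <;> by_cases hc : c = 0 <;> simp_all
  obtain ⟨Φ, hΦ, hΦW⟩ := hP (r + 1) S.card (fun i ↦ z i) W hblock
  refine ⟨fun x ↦ WithLp.toLp 2 fun a ↦ conj ((Φ 0 a : X → ℂ) x), fun x hx ↦ ?_, ?_⟩
  · ext a
    simpa [z, W] using congrArg conj (hΦW (S.equivFin ⟨x, hx⟩) 0 a)
  · simpa [PiLp.inner_apply, mul_comm] using hΦ.posSemidef_row 0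

variable (H) in
/-- The map `b` into a complex inner product space represents the kernel on `S` as
`k(z,w) = 1 / (1 - ⟪b z, b w⟫)`, a pullback of the kernel of the Drury–Arveson space. The identity
is stated without division, so that it also says that `k` has no zeros on `S × S`. -/
def IsDruryArvesonEmbedding {G : Type*} [NormedAddCommGroup G] [InnerProductSpace ℂ G]
    (b : X → G) (S : Set X) : Prop :=
  ∀ z ∈ S, ∀ w ∈ S, ker H z w * (1 - ⟪b z, b w⟫_ℂ) = 1

/-- In a Gram matrix equal to `1` on `S × S`, the points of `S` have the same Gram vector, so the
row at `y` is constant on `S`; its entry at the base point is `1` because `β x₀ = 0`. -/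
theorem IsCompletePick.exists_extension_eq_one (hP : IsCompletePick H) {x₀ : X}
    (hx₀ : ∀ x, ker H x x₀ = 1) {S : Finset X} (hS : x₀ ∈ S) {r : ℕ}
    {b : X → EuclideanSpace ℂ (Fin (r + 1))} (hb : IsDruryArvesonEmbedding H b S) (y : X) :
    ∃ β : X → EuclideanSpace ℂ (Fin (r + 1)), 1 ≤ ker H y y * (1 - ⟪β y, β y⟫_ℂ) ∧
      ∀ z ∈ insert y (S : Set X), ∀ w ∈ insert y (S : Set X), ¬(z = y ∧ w = y) →
        ker H z w * (1 - ⟪β z, β w⟫_ℂ) = 1 := by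
  obtain ⟨β, hβb, hβ⟩ := hP.exists_extension S b <| by
    convert! posSemidef_gram (𝕜 := ℂ) fun _ : S ↦ (1 : ℂ) using 1
    ext z w
    simpa using hb z z.2 w w.2
  set M : Matrix X X ℂ := of fun z w ↦ ker H z w * (1 - ⟪β z, β w⟫_ℂ) with hM
  have hMS : ∀ z ∈ S, ∀ w ∈ S, M z w = 1 := fun z hz w hw ↦ by
    rw [hM, of_apply, hβb z hz, hβb w hw, hb z hz w hw]
  have hβx₀ : β x₀ = 0 := by
    simpa [hM, hx₀] using hMS x₀ hS x₀ hS
  have hrow : ∀ z ∈ S, M y z = 1 := fun z hz ↦ by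
    have hz₀ := hMS z hz x₀ hS
    rw [apply_eq_apply_of_posSemidef hβ ((hMS z hz z hz).trans hz₀.symm)
      ((hMS x₀ hS x₀ hS).trans hz₀.symm) y]
    simp [hM, hβx₀, hx₀]
  have hcol : ∀ z ∈ S, M z y = 1 := fun z hz ↦ by
    rw [← hβ.1.apply, hrow z hz, star_one]
  refine ⟨β, one_le_apply_self_of_posSemidef hβ (hMS x₀ hS x₀ hS) (hcol x₀ hS), ?_⟩
  rintro z (rfl | hz) w (rfl | hw) hzw
  · exact absurd ⟨rfl, rfl⟩ hzw
  exacts [hrow w hw, hcol z hz, hMS z hz w hw]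

theorem inner_toLp_cons {r : ℕ} (a c : ℂ) (u v : EuclideanSpace ℂ (Fin r)) :
    ⟪(WithLp.toLp 2 (Fin.cons a u) : EuclideanSpace ℂ (Fin (r + 1))),
      WithLp.toLp 2 (Fin.cons c v)⟫_ℂ = conj a * c + ⟪u, v⟫_ℂ := by
  simp [PiLp.inner_apply, Fin.sum_univ_succ, mul_comm]

/-- The extension to `y` only misses the diagonal entry at `y`, where the inner product is too
small; a new coordinate supported at `y` makes up for it. -/
theorem IsCompletePick.exists_embedding_insert (hP : IsCompletePick H) {x₀ : X}
    (hx₀ : ∀ x, ker H x x₀ = 1) {S : Finset X} (hS : x₀ ∈ S) {r : ℕ}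
    {b : X → EuclideanSpace ℂ (Fin (r + 1))} (hb : IsDruryArvesonEmbedding H b S) (y : X) :
    ∃ b' : X → EuclideanSpace ℂ (Fin (r + 2)),
      IsDruryArvesonEmbedding H b' (insert y (S : Set X)) := by
  classical
  obtain ⟨β, hy, hβ⟩ := hP.exists_extension_eq_one hx₀ hS hb y
  obtain ⟨s, hs⟩ : ∃ s : ℝ, ker H y y * (1 - (s ^ 2 + ⟪β y, β y⟫_ℂ)) = 1 := by
    have hκ : 0 < ‖kerVec H y‖ ^ 2 := by
      have := kerVec_ne_zero hx₀ y
      positivity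
    have hβy : ⟪β y, β y⟫_ℂ = ((‖β y‖ ^ 2 : ℝ) : ℂ) := by
      rw [inner_self_eq_norm_sq_to_K, Complex.ofReal_pow]
      rfl
    rw [hβy, ker_self] at hy ⊢
    norm_cast at hy ⊢
    have hnonneg : 0 ≤ 1 - ‖β y‖ ^ 2 - (‖kerVec H y‖ ^ 2)⁻¹ := by
      rwa [sub_nonneg, inv_le_iff_one_le_mul₀ hκ, mul_comm]
    refine ⟨√(1 - ‖β y‖ ^ 2 - (‖kerVec H y‖ ^ 2)⁻¹), ?_⟩
    rw [Real.sq_sqrt hnonneg]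
    linear_combination mul_inv_cancel₀ hκ.ne'
  refine ⟨fun z ↦ WithLp.toLp 2 (Fin.cons (if z = y then (s : ℂ) else 0) (β z)), ?_⟩
  intro z hz w hw
  rw [inner_toLp_cons]
  by_cases h : z = y ∧ w = y
  · obtain ⟨rfl, rfl⟩ := h
    simpa [sq] using hs
  · have := hβ z hz w hw h
    rw [not_and_or] at h
    rcases h with h | h <;> simpa [h] using this

theorem IsCompletePick.exists_finite_embedding (hP : IsCompletePick H) {x₀ : X}
    (hx₀ : ∀ x, ker H x x₀ = 1) (S : Finset X) :
    ∃ (r : ℕ) (b : X → EuclideanSpace ℂ (Fin (r + 1))), IsDruryArvesonEmbedding H b S := by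
  classical
  suffices h : ∃ (r : ℕ) (b : X → EuclideanSpace ℂ (Fin (r + 1))),
      IsDruryArvesonEmbedding H b (insert x₀ S : Finset X) by
    obtain ⟨r, b, hb⟩ := h
    exact ⟨r, b, fun z hz w hw ↦ hb z (by simp_all) w (by simp_all)⟩
  induction S using Finset.induction_on with
  | empty => exact ⟨0, 0, by simp [IsDruryArvesonEmbedding, hx₀]⟩
  | insert y S _ ih =>
    obtain ⟨r, b, hb⟩ := ih
    obtain ⟨b', hb'⟩ := hP.exists_embedding_insert hx₀ (Finset.mem_insert_self x₀ S) hb y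
    exact ⟨r + 1, b', by rwa [Finset.insert_comm, Finset.coe_insert]⟩

theorem IsCompletePick.ker_ne_zero (hP : IsCompletePick H) {x₀ : X}
    (hx₀ : ∀ x, ker H x x₀ = 1) (z w : X) : ker H z w ≠ 0 := by
  classical
  obtain ⟨r, b, hb⟩ := hP.exists_finite_embedding hx₀ {z, w}
  exact left_ne_zero_of_mul_eq_one (hb z (by simp) w (by simp))

/-- The McCullough–Quiggin property. -/
theorem IsCompletePick.posSemidef_one_sub_inv_ker (hP : IsCompletePick H) {x₀ : X}
    (hx₀ : ∀ x, ker H x x₀ = 1) : (of fun z w ↦ 1 - (ker H z w)⁻¹).PosSemidef := by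
  refine ⟨?_, fun c ↦ ?_⟩
  · ext z w
    simp [Matrix.conjTranspose_apply, conj_ker]
  · obtain ⟨r, b, hb⟩ := hP.exists_finite_embedding hx₀ c.support
    convert! (posSemidef_gram (𝕜 := ℂ) b).2 c using 1
    refine Finsupp.sum_congr fun z hz ↦ Finsupp.sum_congr fun w hw ↦ ?_
    rw [of_apply, gram_apply, ← eq_inv_of_mul_eq_one_right (hb z hz w hw), sub_sub_cancel]

/-- The Agler–McCarthy theorem. -/
theorem IsCompletePick.exists_embedding (hP : IsCompletePick H) {x₀ : X}
    (hx₀ : ∀ x, ker H x x₀ = 1) :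
    ∃ (G : Type u) (_ : NormedAddCommGroup G) (_ : InnerProductSpace ℂ G) (b : X → G),
      IsDruryArvesonEmbedding H b Set.univ := by
  obtain ⟨G, _, _, b, hb⟩ := exists_gram_eq_of_posSemidef (hP.posSemidef_one_sub_inv_ker hx₀)
  refine ⟨G, inferInstance, inferInstance, b, fun z _ w _ ↦ ?_⟩
  have hzw : ⟪b z, b w⟫_ℂ = 1 - (ker H z w)⁻¹ := congrFun₂ hb z w
  rw [hzw, sub_sub_cancel, mul_inv_cancel₀ (hP.ker_ne_zero hx₀ z w)]

end CompletePick

namespace IsDruryArvesonEmbedding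

open scoped TensorProduct

variable {X H G : Type*} [NormedAddCommGroup H] [InnerProductSpace ℂ H] [CompleteSpace H]
  [RKHS ℂ H X ℂ] [NormedAddCommGroup G] [InnerProductSpace ℂ G] {b : X → G}

theorem posSemidef_gram_kerVec_sub_gram_tmul (hb : IsDruryArvesonEmbedding H b Set.univ) :
    (gram ℂ (kerVec H) - gram ℂ fun x ↦ kerVec H x ⊗ₜ[ℂ] b x).PosSemidef := by
  convert! posSemidef_gram (𝕜 := ℂ) fun _ : X ↦ (1 : ℂ) using 1
  ext z w
  simpa [TensorProduct.inner_tmul, ← ker_eq_inner, mul_sub] using hb z trivial w trivial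

theorem exists_apply_eq_inner_tmul (hb : IsDruryArvesonEmbedding H b Set.univ) (t : H ⊗[ℂ] G) :
    ∃ h : H, ‖h‖ ≤ ‖t‖ ∧ ∀ x, h x = ⟪kerVec H x ⊗ₜ[ℂ] b x, t⟫_ℂ :=
  (posSemidef_gram_kerVec_sub_gram_iff (E := H ⊗[ℂ] G) _).1
    hb.posSemidef_gram_kerVec_sub_gram_tmul t

/-- The coordinate function `⟪b ·, γ⟫` of an embedding, as a multiplier. -/
noncomputable def coordMult (hb : IsDruryArvesonEmbedding H b Set.univ) (γ : G) : Mult H :=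
  ⟨fun x ↦ ⟪b x, γ⟫_ℂ, fun f ↦ by
    obtain ⟨h, -, hh⟩ := hb.exists_apply_eq_inner_tmul (f ⊗ₜ γ)
    refine ⟨h, funext fun x ↦ ?_⟩
    rw [hh, TensorProduct.inner_tmul, inner_kerVec_left, Pi.mul_apply, mul_comm]⟩

theorem coordMult_apply (hb : IsDruryArvesonEmbedding H b Set.univ) (γ : G) (x : X) :
    (hb.coordMult γ : X → ℂ) x = ⟪b x, γ⟫_ℂ := rfl

theorem posSemidef_gram_tmul_sub_gram_coordMult (hb : IsDruryArvesonEmbedding H b Set.univ)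
    {ι : Type*} (q : ι → H) (γ : ι → G) :
    (gram ℂ (fun i ↦ q i ⊗ₜ[ℂ] γ i) -
      gram ℂ fun i ↦ mulOp (hb.coordMult (γ i)) (q i)).PosSemidef := by
  refine (posSemidef_gram_sub_gram_iff (E := H ⊗[ℂ] G) _ _).2 fun c ↦ ?_
  obtain ⟨h, hle, hh⟩ :=
    hb.exists_apply_eq_inner_tmul (c.linearCombination ℂ fun i ↦ q i ⊗ₜ[ℂ] γ i)
  convert hle
  refine RKHS.ext fun x ↦ ?_
  rw [hh, ← inner_kerVec_left]
  simp only [Finsupp.linearCombination_apply, Finsupp.inner_sum, inner_smul_right,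
    inner_kerVec_left, mulOp_apply_apply, coordMult_apply, TensorProduct.inner_tmul, mul_comm]

theorem norm_mulOp_coordMult_le (hb : IsDruryArvesonEmbedding H b Set.univ) (γ : G) (f : H) :
    ‖mulOp (hb.coordMult γ) f‖ ≤ ‖γ‖ * ‖f‖ := by
  have := (posSemidef_gram_sub_gram_iff (E := H ⊗[ℂ] G) _ _).1
    (hb.posSemidef_gram_tmul_sub_gram_coordMult (fun _ : Unit ↦ f) fun _ ↦ γ) (Finsupp.single () 1)
  simpa [TensorProduct.norm_tmul, mul_comm] using this

theorem norm_lt_one (hb : IsDruryArvesonEmbedding H b Set.univ) (z : X) : ‖b z‖ < 1 := by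
  have h : ‖kerVec H z‖ ^ 2 * (1 - ‖b z‖ ^ 2) = 1 := by
    have := hb z trivial z trivial
    rw [ker_self, inner_self_eq_norm_sq_to_K] at this
    apply_fun Complex.re at this
    simpa [← Complex.ofReal_pow] using this
  have : 0 < 1 - ‖b z‖ ^ 2 := pos_of_mul_pos_right (h ▸ one_pos) (by positivity)
  nlinarith [norm_nonneg (b z)]

/-- Multiplication by `⟪b ·, b z⟫` is a strict contraction and `k(·,z) = (1 - ⟪b ·, b z⟫)⁻¹`. -/
theorem ker_mem_mult (hb : IsDruryArvesonEmbedding H b Set.univ) (z : X) :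
    (fun x ↦ ker H x z) ∈ Mult H := by
  intro f
  let L : H →L[ℂ] H := (mulOp (hb.coordMult (b z))).mkContinuous ‖b z‖
    (hb.norm_mulOp_coordMult_le (b z))
  have hL : ‖L‖ < 1 :=
    (LinearMap.mkContinuous_norm_le _ (norm_nonneg _) _).trans_lt (hb.norm_lt_one z)
  refine ⟨(Units.oneSub L hL)⁻¹.val f, funext fun x ↦ ?_⟩
  set g := (Units.oneSub L hL)⁻¹.val f
  have hgf : f = g - mulOp (hb.coordMult (b z)) g := by
    have := DFunLike.congr_fun (Units.oneSub L hL).mul_inv f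
    exact this.symm
  have hgx := hb x trivial z trivial
  rw [Pi.mul_apply, hgf, RKHS.coe_sub, Pi.sub_apply, mulOp_apply_apply, coordMult_apply]
  linear_combination (-g x) * hgx

/-- The kernel function `k(·, z)`, as a multiplier. -/
noncomputable def kerMult (hb : IsDruryArvesonEmbedding H b Set.univ) (z : X) : Mult H :=
  ⟨fun x ↦ ker H x z, hb.ker_mem_mult z⟩

theorem mulOp_kerMult_apply (hb : IsDruryArvesonEmbedding H b Set.univ) (z : X) (f : H) (x : X) :
    mulOp (hb.kerMult z) f x = ker H x z * f x :=
  mulOp_apply_apply _ _ _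

theorem mulOp_coordMult_mulOp_kerMult (hb : IsDruryArvesonEmbedding H b Set.univ) (z : X) (f : H) :
    mulOp (hb.coordMult (b z)) (mulOp (hb.kerMult z) f) = mulOp (hb.kerMult z) f - f := by
  refine RKHS.ext fun x ↦ ?_
  rw [mulOp_apply_apply, RKHS.coe_sub, Pi.sub_apply, mulOp_kerMult_apply, coordMult_apply]
  linear_combination (-f x) * hb x trivial z trivial

/-- The Schur product of `k` with the inequality saying that the coordinates of `b` form a row
contraction, evaluated at the tensors `k(·,z) p(z) ⊗ b z`. -/
theorem posSemidef_ker_mul (hb : IsDruryArvesonEmbedding H b Set.univ) (p : X → H) :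
    (of fun z w ↦ ker H z w * (⟪p z, mulOp (hb.kerMult w) (p w)⟫_ℂ +
      ⟪mulOp (hb.kerMult z) (p z), p w⟫_ℂ - ⟪p z, p w⟫_ℂ)).PosSemidef := by
  let q (z : X) : H := mulOp (hb.kerMult z) (p z)
  have hq := hb.posSemidef_gram_tmul_sub_gram_coordMult q b
  simp only [q, mulOp_coordMult_mulOp_kerMult] at hq
  convert! ((posSemidef_gram (kerVec H)).hadamard hq).add (posSemidef_gram q) using 1
  ext z w
  simp only [of_apply, Matrix.add_apply, hadamard_apply, Matrix.sub_apply, gram_apply,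
    ← ker_eq_inner, TensorProduct.inner_tmul, inner_sub_left, inner_sub_right, q]
  linear_combination ⟪q z, q w⟫_ℂ * hb z trivial w trivial

/-- The function `z ↦ ⟪f, k(·,z) f⟫`. If `s` denotes its conjugate, then `2 s - ‖f‖ ^ 2` is the
Sarason function of `f`. -/
noncomputable def sarason (hb : IsDruryArvesonEmbedding H b Set.univ) (f : H) (z : X) : ℂ :=
  ⟪f, mulOp (hb.kerMult z) f⟫_ℂ

theorem inner_mulOp_kerMult_right (hb : IsDruryArvesonEmbedding H b Set.univ) (f : H) (z : X) :
    ⟪f, mulOp (hb.kerMult z) f⟫_ℂ = hb.sarason f z := rfl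

theorem inner_mulOp_kerMult_left (hb : IsDruryArvesonEmbedding H b Set.univ) (f : H) (z : X) :
    ⟪mulOp (hb.kerMult z) f, f⟫_ℂ = conj (hb.sarason f z) :=
  (inner_conj_symm ..).symm

theorem sarason_ne_zero (hb : IsDruryArvesonEmbedding H b Set.univ) {f : H} (hf : ‖f‖ = 1)
    (z : X) : hb.sarason f z ≠ 0 := by
  intro hs
  have hdiag := (hb.posSemidef_ker_mul fun _ ↦ f).diag_nonneg (i := z)
  rw [of_apply, inner_mulOp_kerMult_left, inner_mulOp_kerMult_right, hs, map_zero,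
    inner_self_eq_one_of_norm_eq_one hf, ker_self] at hdiag
  have hk : kerVec H z = 0 := by
    norm_cast at hdiag
    simpa using hdiag
  simpa [ker_self, hk] using hb z trivial z trivial

theorem exists_contractive_eq_one_sub_inv_sarason (hb : IsDruryArvesonEmbedding H b Set.univ)
    {f : H} (hf : ‖f‖ = 1) :
    ∃ ψ : Mult H, (ψ : X → ℂ) = (fun z ↦ 1 - (conj (hb.sarason f z))⁻¹) ∧
      ∀ g, ‖mulOp ψ g‖ ≤ ‖g‖ := by
  refine exists_mult_of_posSemidef ?_
  convert! hb.posSemidef_ker_mul fun z ↦ (hb.sarason f z)⁻¹ • f using 1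
  ext z w
  have hz := hb.sarason_ne_zero hf z
  have hw := hb.sarason_ne_zero hf w
  have hz' : conj (hb.sarason f z) ≠ 0 := (map_ne_zero _).2 hz
  simp only [of_apply, map_smul, inner_smul_left, inner_smul_right, inner_mulOp_kerMult_left,
    inner_mulOp_kerMult_right, inner_self_eq_one_of_norm_eq_one hf, map_inv₀, map_sub, map_one,
    Complex.conj_conj]
  field_simp
  ring

theorem mulOp_kerMult_kerVec (hb : IsDruryArvesonEmbedding H b Set.univ) {x₀ : X}
    (hx₀ : ∀ x, ker H x x₀ = 1) (z : X) :
    mulOp (hb.kerMult z) (kerVec H x₀) = kerVec H z :=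
  RKHS.ext fun x ↦ by rw [mulOp_kerMult_apply, kerVec_apply, kerVec_apply, hx₀, mul_one]

theorem exists_mult_eq_div_sarason (hb : IsDruryArvesonEmbedding H b Set.univ) {x₀ : X}
    (hx₀ : ∀ x, ker H x x₀ = 1) {f : H} (hf : ‖f‖ = 1) :
    ∃ φ : Mult H, (φ : X → ℂ) = fun z ↦ f z / conj (hb.sarason f z) := by
  let η (z : X) : ℂ := conj (f z) / hb.sarason f z
  let p (z : X) : H := kerVec H x₀ - η z • f
  have hinner (z w : X) : ⟪p z, mulOp (hb.kerMult w) (p w)⟫_ℂ = 1 - η w * f x₀ := by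
    have hf_orth : ⟪f, mulOp (hb.kerMult w) (p w)⟫_ℂ = 0 := by
      rw [map_sub, map_smul, mulOp_kerMult_kerVec hb hx₀, inner_sub_right, inner_smul_right,
        inner_kerVec_right, inner_mulOp_kerMult_right,
        div_mul_cancel₀ _ (hb.sarason_ne_zero hf w), sub_self]
    have hker : ker H x₀ w = 1 := by rw [← conj_ker, hx₀, map_one]
    rw [inner_sub_left, inner_smul_left, hf_orth, mul_zero, sub_zero, inner_kerVec_left,
      mulOp_kerMult_apply, hker, one_mul, RKHS.coe_sub, RKHS.coe_smul, Pi.sub_apply,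
      Pi.smul_apply, kerVec_apply, hx₀, smul_eq_mul]
  have hp (z w : X) : ⟪p z, p w⟫_ℂ =
      1 - η w * f x₀ - conj (η z * f x₀) + conj (η z) * η w := by
    simp only [p, inner_sub_left, inner_sub_right, inner_smul_left, inner_smul_right,
      inner_self_eq_one_of_norm_eq_one hf, inner_kerVec_left, inner_kerVec_right, kerVec_apply,
      hx₀, map_mul, map_one]
    ring
  have hpos : (of fun z w ↦ ker H z w * (1 - conj (η z) * conj (conj (η w)))).PosSemidef := by
    convert! hb.posSemidef_ker_mul p using 1
    ext z w
    rw [of_apply, of_apply, ← inner_conj_symm (mulOp _ _) (p w), hinner, hinner, hp]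
    simp only [map_sub, map_one, Complex.conj_conj]
    ring
  obtain ⟨φ, hφ, -⟩ := exists_mult_of_posSemidef hpos
  exact ⟨φ, by simp [hφ, η]⟩

end IsDruryArvesonEmbedding

section Multiplicative

variable {X H : Type*} [NormedAddCommGroup H] [InnerProductSpace ℂ H] [CompleteSpace H]
  [RKHS ℂ H X ℂ]

theorem IsCompletePick.exists_mult_eq_one_sub_mul (hP : IsCompletePick H)
    (hN : IsNormalized H) (f : H) :
    ∃ φ ψ : Mult H, (φ : X → ℂ) = ((1 - ψ : Mult H) : X → ℂ) * f ∧
      (∀ g, ‖mulOp ψ g‖ ≤ ‖g‖) ∧ ∀ x, (ψ : X → ℂ) x ≠ 1 := by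
  obtain ⟨x₀, hx₀⟩ := hN
  rcases eq_or_ne f 0 with rfl | hf
  · refine ⟨0, 0, by simp, fun g ↦ ?_, by simp⟩
    have : mulOp (0 : Mult H) g = 0 := RKHS.ext fun x ↦ by simp [mulOp_apply_apply]
    simp [this]
  obtain ⟨G, _, _, b, hb⟩ := hP.exists_embedding hx₀
  set u : H := (‖f‖⁻¹ : ℂ) • f
  have hu : ‖u‖ = 1 := norm_smul_inv_norm hf
  have hfu : f = (‖f‖ : ℂ) • u := (smul_inv_smul₀ (by simpa using hf) f).symm
  obtain ⟨φ, hφ⟩ := hb.exists_mult_eq_div_sarason hx₀ hu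
  obtain ⟨ψ, hψ, hle⟩ := hb.exists_contractive_eq_one_sub_inv_sarason hu
  refine ⟨(‖f‖ : ℂ) • φ, ψ, funext fun x ↦ ?_, hle, fun x ↦ ?_⟩
  · have hfx : f x = ‖f‖ * u x := by
      conv_lhs => rw [hfu, RKHS.coe_smul, Pi.smul_apply, smul_eq_mul]
    simp only [Complex.coe_smul, SetLike.val_smul_of_tower, hφ, Pi.smul_apply, Complex.real_smul,
      AddSubgroupClass.coe_sub, OneMemClass.coe_one, hψ, Pi.mul_apply, Pi.sub_apply,
      Pi.one_apply, sub_sub_cancel, hfx]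
    ring
  · simpa [hψ] using hb.sarason_ne_zero hu x

/-- The Riesz vector of `ρ` is fixed by `M_ψ*`, hence by `M_ψ` as `M_ψ` is a contraction. -/
theorem eq_zero_of_comp_mulOp_eq {ψ : Mult H} (hψ : ∀ g, ‖mulOp ψ g‖ ≤ ‖g‖)
    (hψ₁ : ∀ x, (ψ : X → ℂ) x ≠ 1) {ρ : H →L[ℂ] ℂ} (hρ : ∀ g, ρ (mulOp ψ g) = ρ g) : ρ = 0 := by
  set h : H := (InnerProductSpace.toDual ℂ H).symm ρ
  have hh (g : H) : ⟪h, mulOp ψ g⟫_ℂ = ⟪h, g⟫_ℂ := by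
    simpa only [h, InnerProductSpace.toDual_symm_apply] using hρ g
  have hfix : mulOp ψ h = h := by
    refine eq_of_norm_le_re_inner_eq_norm_sq (𝕜 := ℂ) (hψ h) ?_
    rw [← inner_conj_symm, hh, inner_conj_symm, inner_self_eq_norm_sq]
  have hzero : h = 0 := RKHS.ext fun x ↦ by
    have hx : (ψ : X → ℂ) x * h x = h x := by rw [← mulOp_apply_apply, hfix]
    rw [RKHS.coe_zero, Pi.zero_apply]
    exact (mul_left_eq_self₀.1 hx).resolve_left (hψ₁ x)
  exact (LinearIsometryEquiv.map_eq_zero_iff _).1 hzero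

end Multiplicative

end PickSpace

open PickSpace in
theorem corollary1p3 {X : Type*} {H : Type*} [NormedAddCommGroup H] [InnerProductSpace ℂ H]
    [CompleteSpace H] [RKHS ℂ H X ℂ] (hN : PickSpace.IsNormalized H)
    (hP : PickSpace.IsCompletePick H) (ρ : H →L[ℂ] ℂ) (hρ : ρ ≠ 0) :
    (∀ (φ : PickSpace.Mult H) (g : H),
        ρ (PickSpace.mulOp φ g) = ρ (PickSpace.multToSpace hN φ) * ρ g) ↔
      (∀ f g h : H, (h : X → ℂ) = (f : X → ℂ) * (g : X → ℂ) → ρ h = ρ f * ρ g) := by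
  refine ⟨fun hmul f g h hfg ↦ ?_, fun hmul φ g ↦ hmul _ _ _ ?_⟩
  · obtain ⟨φ, ψ, hφ, hψ, hψ₁⟩ := hP.exists_mult_eq_one_sub_mul hN f
    have hh : mulOp (1 - ψ) h = mulOp φ g := DFunLike.coe_injective <| by
      rw [coe_mulOp, coe_mulOp, hfg, hφ, mul_assoc]
    have hf : multToSpace hN φ = mulOp (1 - ψ) f := DFunLike.coe_injective <| by
      rw [coe_multToSpace, hφ, coe_mulOp]
    have hne : ρ (multToSpace hN (1 - ψ)) ≠ 0 := fun h0 ↦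
      hρ <| eq_zero_of_comp_mulOp_eq hψ hψ₁ fun k ↦ by
        rw [eq_comm, ← sub_eq_zero, ← map_sub, ← mulOp_one_sub_apply, hmul, h0, zero_mul]
    apply mul_left_cancel₀ hne
    rw [← hmul, hh, hmul, hf, hmul, mul_assoc]
  · rw [coe_mulOp, coe_multToSpace]
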